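/- Let $\mathbb B^3=\{z\in\mathbb C^3:\|z\|<1\}$ be the open unit ball (Euclidean norm) and $\overline{\mathbb B}^3$ its closure. For open sets $U\subseteq\Omega\subseteq\mathbb C^3$, call $(U,\Omega)$ a Runge pair if every holomorphic function on $U$ can be approximated, uniformly on every compact subset of $U$, by holomorphic functions on $\Omega$. For every $\varepsilon>0$ there exists a continuous injective map $\phi:\overline{\mathbb B}^3\to\mathbb C^3$, holomorphic on $\mathbb B^3$, such that (i) $\sup_{z\in\overline{\mathbb B}^3}\|\phi(z)-z\|<\varepsilon$, and (ii) for every domain (connected open set) $\Omega\subseteq\mathbb C^3$ such that $(\phi(\mathbb B^3),\Omega)$ is a Runge pair, $\phi(\mathbb B^3)=\Omega$. -/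

import Mathlib

/-- `(U, Ω)` is a Runge pair of open subsets of `ℂⁿ`: `U ⊆ Ω`, and every holomorphic function on
`U` can be approximated, uniformly on every compact subset of `U`, by holomorphic functions
on `Ω`. -/
structure IsRungePair {n : ℕ} (U Ω : Set (EuclideanSpace ℂ (Fin n))) : Prop where
  isOpen_left : IsOpen U
  isOpen_right : IsOpen Ω
  subset : U ⊆ Ω
  approx : ∀ f : EuclideanSpace ℂ (Fin n) → ℂ, DifferentiableOn ℂ f U →
    ∀ K : Set (EuclideanSpace ℂ (Fin n)), IsCompact K → K ⊆ U → ∀ η : ℝ, 0 < η →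
      ∃ g : EuclideanSpace ℂ (Fin n) → ℂ, DifferentiableOn ℂ g Ω ∧ ∀ z ∈ K, ‖g z - f z‖ < η

/-!
The maps `f n` converging to `φ` are biholomorphic embeddings of neighbourhoods of the closed ball,
and `f (n + 1) = f n ∘ ψ n`, where `ψ n` is very close to the identity and creates an obstruction to
Runge approximation near the boundary point `f n (q n)`. The points `q n` are dense in the sphere.

The obstruction is a circle `κ` in the open ball on which a linear form `l` equals `ρ ζ⁻¹`, while
`ψ n ∘ κ` bounds a holomorphic disc close to `q n`. The function `l ∘ (f (n + 1))⁻¹` is holomorphic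
on `φ '' ball`. It equals `ρ ζ⁻¹` on the boundary of the disc `D` that is the image under `f n` of
the previous one. If `Ω` contains `D`, then a function that is holomorphic on `Ω` has integral zero
along the boundary of `D`, and so cannot be close to `ρ ζ⁻¹` there
(`not_isRungePair_of_hasDiscObstruction`). If `Ω` is connected and strictly larger than
`φ '' ball`, it contains a point of the boundary, hence some disc `D`.

The map `ψ` for the pole `(0, 0, 1)` is `fingerMap N`, with `N` large. In coordinates `(s, t, w)` it
first changes `w` to `w + (3/2) e^{1/3 - N (1 - w)} s t` up to a small shift, a small change which
lets a finger stick out of the ball: after rescaling, the real part of the new coordinate is largest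
where `re (N (1 - w)) = 1/3` and `‖N s t‖ = 1/3`. It then changes `t` to `(e^{L t} - 1) / L`, where
`L = 2πi g N s` and the gate `g`, an exponential function of the new third coordinate, is negligible
except at the tip of the finger. On the circle `s = ρ ζ`, `t = ρ ζ⁻¹` in the tip one has `L t =
2πi`, so its image is the boundary of a flat disc. Injectivity holds because at a given height in
the tip the product `s t` is almost determined (`norm_gate_mul_sub_lt_one`), so two values of `L t`
cannot differ by a nonzero multiple of `2πi`. All estimates are independent of `N` in the variables
`ω = N (1 - w)` and `μ = N s t`, which satisfy `‖μ‖ ≤ re ω` on the ball.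

The approximation is controlled by tolerances: points within the tolerance of `f n x` have a
preimage close to `x` (`IsBiholEmbedding.exists_tolerance`). This gives the injectivity of the limit
and, by a connectedness argument, shows that the boundaries of the discs remain in `φ '' ball`.
-/

/-! ### The scale-free model of the finger -/

/-- The height `ω - (3/2) e^{1/3 - ω} μ` of the finger in rescaled coordinates. Here `ω` is the
rescaled depth below the pole of the ball and `μ` the rescaled product of the two other coordinates;
in these coordinates the ball is contained in `‖μ‖ ≤ re ω`. On that set the real part of the height
is at least `-1/6`, with equality at `ω = μ = 1/3`. -/
noncomputable def fingerHeight (ω μ : ℂ) : ℂ := ω - 3 / 2 * Complex.exp (1 / 3 - ω) * μ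

/-- The value of `μ` on the circle used for the obstruction, slightly less than the critical
value `1/3`. -/
noncomputable def circleLevel : ℝ := 1 / 3 - 1 / 10 ^ 6

/-- The gate: an exponential that decays rapidly as the real part of the height grows away from its
extremal value `-1/6`. It is normalised so that its value at the height of the circle is `1 / circleLevel`. -/
noncomputable def gate (ν : ℂ) : ℂ :=
  (circleLevel : ℂ)⁻¹ * Complex.exp (3 / 20 - 10 ^ 5 * (ν + 1 / 6))

lemma circleLevel_pos : 0 < circleLevel := by norm_num [circleLevel]

lemma gate_ne_zero (ν : ℂ) : gate ν ≠ 0 := by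
  have := circleLevel_pos.ne'
  simp [gate, Complex.exp_ne_zero, this]

lemma norm_gate (ν : ℂ) :
    ‖gate ν‖ = circleLevel⁻¹ * Real.exp (3 / 20 - 10 ^ 5 * (ν.re + 1 / 6)) := by
  rw [gate, norm_mul, Complex.norm_exp, norm_inv, Complex.norm_real, Real.norm_eq_abs,
    abs_of_pos circleLevel_pos]
  congr 2
  have h : (10 ^ 5 * (ν + 1 / 6) : ℂ) = ((10 ^ 5 : ℝ) : ℂ) * (ν + 1 / 6) := by push_cast; rfl
  have h2 : (3 / 20 : ℂ) = ((3 / 20 : ℝ) : ℂ) := by push_cast; rfl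
  have h3 : (1 / 6 : ℂ) = ((1 / 6 : ℝ) : ℂ) := by push_cast; rfl
  rw [Complex.sub_re, h, Complex.re_ofReal_mul, h2, h3, Complex.add_re, Complex.ofReal_re,
    Complex.ofReal_re]

lemma fingerHeight_circle : fingerHeight (1 / 3) circleLevel = -1 / 6 + 3 / 2 * 1 / 10 ^ 6 := by
  simp [fingerHeight, circleLevel]; ring

lemma gate_circle : gate (fingerHeight (1 / 3) circleLevel) * circleLevel = 1 := by
  have : (circleLevel : ℂ) ≠ 0 := by exact_mod_cast circleLevel_pos.ne'
  rw [fingerHeight_circle, gate]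
  norm_num
  field_simp

/-- The height in terms of `m = μ e^{-i im ω}` and `η = (3/2) e^{1/3 - re ω}`. The final inequality
bounds its real part from below: `-1/6` plus a quadratic term in the distance of `re ω` from `1/3`
plus a multiple of `re ω - re m`. -/
lemma fingerHeight_polar (ω μ : ℂ) (h : ‖μ‖ ≤ ω.re) :
    ∃ (m : ℂ) (η : ℝ), μ = m * Complex.exp (ω.im * Complex.I) ∧ ‖m‖ ≤ ω.re ∧
      η = 3 / 2 * Real.exp (-(ω.re - 1 / 3)) ∧
      (fingerHeight ω μ).re = ω.re - η * m.re ∧ (fingerHeight ω μ).im = ω.im - η * m.im ∧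
      (ω.re - 1 / 3) ^ 2 + η * (ω.re - m.re) * (ω.re + 2 / 3) ≤
        ((fingerHeight ω μ).re + 1 / 6) * (ω.re + 2 / 3) := by
  set x := ω.re with hx
  have hx0 : 0 ≤ x := (norm_nonneg μ).trans h
  set m := μ * Complex.exp (-(ω.im * Complex.I)) with hm
  set η := 3 / 2 * Real.exp (-(x - 1 / 3)) with hη
  have hf : fingerHeight ω μ = ω - η * m := by
    have : (3 / 2 : ℂ) * Complex.exp (1 / 3 - ω) * μ = η * m := by
      rw [hm, hη]
      have : (1 / 3 - ω : ℂ) = ((-(x - 1 / 3) : ℝ) : ℂ) + -(ω.im * Complex.I) := by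
        conv_lhs => rw [← Complex.re_add_im ω]
        push_cast; ring
      rw [this, Complex.exp_add]; push_cast; ring
    rw [fingerHeight, this]
  have hre : (fingerHeight ω μ).re = x - η * m.re := by
    rw [hf, Complex.sub_re, Complex.re_ofReal_mul]
  refine ⟨m, η, ?_, ?_, rfl, hre, ?_, ?_⟩
  · rw [hm, mul_assoc, ← Complex.exp_add]; simp
  · rw [hm, norm_mul, Complex.norm_exp]; simpa using h
  · rw [hf, Complex.sub_im, Complex.im_ofReal_mul]
  · -- this is `e^{-y} ≤ 1 / (1 + y)` for `y = x - 1/3`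
    have hη1 : η * (x + 2 / 3) ≤ 3 / 2 := by
      have h1 := Real.add_one_le_exp (x - 1 / 3)
      have h2 : Real.exp (-(x - 1 / 3)) * Real.exp (x - 1 / 3) = 1 := by
        rw [← Real.exp_add]; simp
      have h3 := Real.exp_pos (-(x - 1 / 3))
      rw [hη]; nlinarith
    rw [hre]
    nlinarith

lemma fingerHeight_re_nonneg {ω μ : ℂ} (h : ‖μ‖ ≤ ω.re) :
    0 ≤ (fingerHeight ω μ).re + 1 / 6 := by
  obtain ⟨m, η, -, h2, h3, -, -, h6⟩ := fingerHeight_polar ω μ h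
  have hx0 : 0 ≤ ω.re := (norm_nonneg μ).trans h
  have hm := (Complex.re_le_norm m).trans h2
  have hη : 0 < η := by rw [h3]; positivity
  have : 0 ≤ η * (ω.re - m.re) * (ω.re + 2 / 3) := by
    have := sub_nonneg.2 hm; positivity
  by_contra! hc
  nlinarith [sq_nonneg (ω.re - 1 / 3)]

/-- The depth is controlled by the height. -/
lemma re_le_fingerHeight {ω μ : ℂ} (h : ‖μ‖ ≤ ω.re) :
    ω.re ≤ (fingerHeight ω μ).re + 1 / 6 + 4 / 3 := by
  obtain ⟨m, η, -, h2, h3, -, -, h6⟩ := fingerHeight_polar ω μ h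
  have hx0 : 0 ≤ ω.re := (norm_nonneg μ).trans h
  have hm := (Complex.re_le_norm m).trans h2
  have hη : 0 < η := by rw [h3]; positivity
  have h7 : 0 ≤ η * (ω.re - m.re) * (ω.re + 2 / 3) := by
    have := sub_nonneg.2 hm; positivity
  have h8 := fingerHeight_re_nonneg h
  by_contra! hc
  nlinarith

/-- Near the extremal height, `μ` is determined up to a small error by the imaginary part of the
height. -/
lemma norm_rotated_sub_le {ω μ : ℂ} (h : ‖μ‖ ≤ ω.re)
    (hs : (fingerHeight ω μ).re + 1 / 6 ≤ 1 / 1000) :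
    ‖μ * Complex.exp (-((fingerHeight ω μ).im * Complex.I)) - 1 / 3‖ ≤ 1 / 10 := by
  obtain ⟨m, η, h1, h2, h3, -, h5, h6⟩ := fingerHeight_polar ω μ h
  have h8 := fingerHeight_re_nonneg h
  set e := (fingerHeight ω μ).re + 1 / 6
  set x := ω.re
  have hx0 : 0 ≤ x := (norm_nonneg μ).trans h
  have hm := (Complex.re_le_norm m).trans h2
  have hη : 0 < η := by rw [h3]; positivity
  have h7 : 0 ≤ η * (x - m.re) := mul_nonneg hη.le (sub_nonneg.2 hm)
  have hx1 : x - 1 / 3 ≤ 33 / 1000 := by by_contra! hc; nlinarith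
  have hx2 : -(33 / 1000) ≤ x - 1 / 3 := by by_contra! hc; nlinarith
  have hη1 : 145 / 100 ≤ η := by
    have := Real.add_one_le_exp (-(x - 1 / 3)); rw [h3]; linarith
  have hη2 : η ≤ 156 / 100 := by
    have a1 := Real.add_one_le_exp (x - 1 / 3)
    have a2 : Real.exp (-(x - 1 / 3)) * Real.exp (x - 1 / 3) = 1 := by
      rw [← Real.exp_add]; simp
    have a3 := Real.exp_pos (-(x - 1 / 3))
    rw [h3]; nlinarith
  have hd : x - m.re ≤ 7 / 10000 := by
    have : η * (x - m.re) ≤ 1 / 1000 := by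
      have : η * (x - m.re) * (x + 2 / 3) ≤ e * (x + 2 / 3) := by
        nlinarith [sq_nonneg (x - 1 / 3)]
      exact (le_of_mul_le_mul_right this (by linarith)).trans hs
    nlinarith
  have hn : ‖m - x‖ ^ 2 ≤ 2 * x * (x - m.re) := by
    have a1 : ‖m - x‖ ^ 2 = (m.re - x) ^ 2 + m.im ^ 2 := by
      rw [← Complex.normSq_eq_norm_sq, Complex.normSq_apply]; simp; ring
    have a2 : ‖m‖ ^ 2 = m.re ^ 2 + m.im ^ 2 := by
      rw [← Complex.normSq_eq_norm_sq, Complex.normSq_apply]; ring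
    nlinarith [norm_nonneg m]
  have hn2 : ‖m - x‖ ≤ 23 / 1000 := by
    apply le_of_sq_le_sq _ (by norm_num)
    nlinarith
  have him : |m.im| ≤ 23 / 1000 := by
    have := Complex.abs_im_le_norm (m - x)
    simp at this
    linarith
  set τ := (fingerHeight ω μ).im
  have key : μ * Complex.exp (-(τ * Complex.I)) =
      m * Complex.exp (Complex.I * ((η * m.im : ℝ) : ℂ)) := by
    rw [h1, mul_assoc, ← Complex.exp_add]
    congr 2
    rw [h5]; push_cast; ring
  have hrot : ‖Complex.exp (Complex.I * ((η * m.im : ℝ) : ℂ)) - 1‖ ≤ 36 / 1000 := by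
    refine (Real.norm_exp_I_mul_ofReal_sub_one_le).trans ?_
    rw [Real.norm_eq_abs, abs_mul, abs_of_pos hη]
    nlinarith [abs_nonneg m.im]
  rw [key]
  have hdec : m * Complex.exp (Complex.I * ((η * m.im : ℝ) : ℂ)) - 1 / 3 =
      m * (Complex.exp (Complex.I * ((η * m.im : ℝ) : ℂ)) - 1) + (m - x) +
      ((x - 1 / 3 : ℝ) : ℂ) := by
    push_cast; ring
  rw [hdec]
  refine (norm_add₃_le).trans ?_
  have e1 : ‖m * (Complex.exp (Complex.I * ((η * m.im : ℝ) : ℂ)) - 1)‖ ≤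
      (367 / 1000) * (36 / 1000) := by
    rw [norm_mul]
    exact mul_le_mul (by linarith) hrot (norm_nonneg _) (by norm_num)
  have e2 : ‖((x - 1 / 3 : ℝ) : ℂ)‖ ≤ 33 / 1000 := by
    rw [Complex.norm_real, Real.norm_eq_abs, abs_le]; exact ⟨hx2, hx1⟩
  linarith

lemma inv_circleLevel_mul_exp_le : circleLevel⁻¹ * Real.exp (3 / 20) ≤ 18 / 5 := by
  have h1 : circleLevel⁻¹ ≤ 301 / 100 := by
    rw [inv_le_comm₀ circleLevel_pos (by norm_num)]; norm_num [circleLevel]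
  have h2 : Real.exp (3 / 20) ≤ 20 / 17 := by
    have a1 := Real.add_one_le_exp (-(3 / 20 : ℝ))
    have a2 : Real.exp (-(3 / 20)) * Real.exp (3 / 20) = 1 := by rw [← Real.exp_add]; simp
    have a3 := Real.exp_pos (3 / 20)
    nlinarith
  calc _ ≤ (301 / 100 : ℝ) * (20 / 17) := mul_le_mul h1 h2 (Real.exp_pos _).le (by norm_num)
    _ ≤ _ := by norm_num

lemma norm_gate_le (ν : ℂ) :
    ‖gate ν‖ ≤ 18 / 5 * Real.exp (-(10 ^ 5 * (ν.re + 1 / 6))) := by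
  rw [norm_gate, sub_eq_add_neg, Real.exp_add, ← mul_assoc]
  exact mul_le_mul_of_nonneg_right inv_circleLevel_mul_exp_le (Real.exp_pos _).le

/-- Points of the model with the same height have values of `μ` that the gate does not separate by
a full period. This is what makes the exponential twist injective: where the gate is large, `μ` is
almost determined by the height. -/
lemma norm_gate_mul_sub_lt_one {ω μ ω' μ' : ℂ} (h : ‖μ‖ ≤ ω.re) (h' : ‖μ'‖ ≤ ω'.re)
    (heq : fingerHeight ω μ = fingerHeight ω' μ') :
    ‖gate (fingerHeight ω μ) * (μ - μ')‖ < 1 := by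
  have h0 := fingerHeight_re_nonneg h
  have hg := norm_gate_le (fingerHeight ω μ)
  rw [norm_mul]
  by_cases hs : (fingerHeight ω μ).re + 1 / 6 ≤ 1 / 1000
  · have a1 := norm_rotated_sub_le h hs
    have a2 := norm_rotated_sub_le h' (heq ▸ hs)
    rw [← heq] at a2
    have a3 : ‖μ - μ'‖ ≤ 1 / 5 := by
      set r := Complex.exp (-((fingerHeight ω μ).im * Complex.I)) with hr
      have hr1 : ‖r‖ = 1 := by rw [hr, Complex.norm_exp]; simp
      have : ‖μ - μ'‖ = ‖(μ * r - 1 / 3) - (μ' * r - 1 / 3)‖ := by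
        rw [sub_sub_sub_cancel_right, ← sub_mul, norm_mul, hr1, mul_one]
      rw [this]
      exact (norm_sub_le _ _).trans (by linarith)
    have a4 : ‖gate (fingerHeight ω μ)‖ ≤ 18 / 5 := by
      refine hg.trans ?_
      have : Real.exp (-(10 ^ 5 * ((fingerHeight ω μ).re + 1 / 6))) ≤ 1 :=
        Real.exp_le_one_iff.2 (by nlinarith)
      linarith
    calc _ ≤ (18 / 5 : ℝ) * (1 / 5) := mul_le_mul a4 a3 (norm_nonneg _) (by norm_num)
      _ < 1 := by norm_num
  · push Not at hs
    have b1 := re_le_fingerHeight h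
    have b2 := re_le_fingerHeight h'
    rw [← heq] at b2
    set e := (fingerHeight ω μ).re + 1 / 6
    have b3 : ‖μ - μ'‖ ≤ 2 * e + 8 / 3 := (norm_sub_le _ _).trans (by linarith)
    have b4 := Real.add_one_le_exp (10 ^ 5 * e)
    have b5 : Real.exp (-(10 ^ 5 * e)) * Real.exp (10 ^ 5 * e) = 1 := by rw [← Real.exp_add]; simp
    have b6 := Real.exp_pos (-(10 ^ 5 * e))
    calc _ ≤ (18 / 5 * Real.exp (-(10 ^ 5 * e))) * (2 * e + 8 / 3) :=
          mul_le_mul hg b3 (norm_nonneg _) (by positivity)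
      _ = Real.exp (-(10 ^ 5 * e)) * (18 / 5 * (2 * e + 8 / 3)) := by ring
      _ < Real.exp (-(10 ^ 5 * e)) * Real.exp (10 ^ 5 * e) :=
          mul_lt_mul_of_pos_left (b4.trans_lt' (by norm_num1; linarith)) b6
      _ = 1 := b5

/-- The constant `3/2 · e^{1/3}` is less than `e`; this gives the slack in the model. -/
lemma mul_exp_lt_one (x : ℝ) : 3 / 2 * x * Real.exp (1 / 3 - x) < 1 := by
  have a1 := Real.add_one_le_exp (x - 1)
  have a2 := Real.add_one_lt_exp (show (2 / 3 : ℝ) ≠ 0 by norm_num)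
  have a3 : Real.exp (x - 1) * Real.exp (2 / 3) * Real.exp (1 / 3 - x) = 1 := by
    rw [← Real.exp_add, ← Real.exp_add]; ring_nf; simp
  have a4 := Real.exp_pos (1 / 3 - x)
  have a5 : 3 / 2 * x < Real.exp (x - 1) * Real.exp (2 / 3) := by
    have := Real.exp_pos (x - 1)
    nlinarith
  nlinarith

/-- For fixed `μ` the height is an injective function of the depth. -/
lemma fingerHeight_injective {ω μ ω' : ℂ} (h : ‖μ‖ ≤ ω.re) (h' : ‖μ‖ ≤ ω'.re)
    (heq : fingerHeight ω μ = fingerHeight ω' μ) : ω = ω' := by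
  have hlip : ‖Complex.exp (1 / 3 - ω') - Complex.exp (1 / 3 - ω)‖ ≤
      Real.exp (1 / 3 - ‖μ‖) * ‖ω' - ω‖ := by
    refine Convex.norm_image_sub_le_of_norm_hasDerivWithin_le (s := {z : ℂ | ‖μ‖ ≤ z.re})
      (f := fun z => Complex.exp (1 / 3 - z)) (f' := fun z => -Complex.exp (1 / 3 - z)) (fun z _ => ?_)
      (fun z hz => ?_) (convex_halfSpace_re_ge _) h h'
    · have := ((hasDerivAt_id z).const_sub (1 / 3 : ℂ)).cexp
      simpa using this.hasDerivWithinAt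
    · rw [norm_neg, Complex.norm_exp]
      refine Real.exp_le_exp.2 ?_
      have : (1 / 3 : ℂ) = ((1 / 3 : ℝ) : ℂ) := by push_cast; rfl
      rw [Complex.sub_re, this, Complex.ofReal_re]
      have : ‖μ‖ ≤ z.re := hz
      linarith
  have hd : ω' - ω = 3 / 2 * μ * (Complex.exp (1 / 3 - ω') - Complex.exp (1 / 3 - ω)) := by
    unfold fingerHeight at heq; linear_combination -heq
  have hc := mul_exp_lt_one ‖μ‖
  by_contra hne
  have hpos : 0 < ‖ω' - ω‖ := norm_pos_iff.2 (sub_ne_zero.2 (Ne.symm hne))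
  have : ‖ω' - ω‖ ≤ 3 / 2 * ‖μ‖ * (Real.exp (1 / 3 - ‖μ‖) * ‖ω' - ω‖) := by
    conv_lhs => rw [hd]
    rw [norm_mul, norm_mul]
    have : ‖(3 / 2 : ℂ)‖ = 3 / 2 := by norm_num
    rw [this]
    gcongr
  nlinarith

/-- The derivative of the height with respect to the depth does not vanish. -/
lemma one_add_exp_mul_ne_zero {ω μ : ℂ} (h : ‖μ‖ ≤ ω.re) :
    1 + 3 / 2 * Complex.exp (1 / 3 - ω) * μ ≠ 0 := by
  obtain ⟨m, η, h1, h2, h3, h4, h5, h6⟩ := fingerHeight_polar ω μ h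
  intro h0
  have hc : fingerHeight ω μ = ω + 1 := by unfold fingerHeight; linear_combination -h0
  have hre : (fingerHeight ω μ).re = ω.re + 1 := by rw [hc]; simp
  have hx0 : 0 ≤ ω.re := (norm_nonneg μ).trans h
  have hm := abs_le.1 ((Complex.abs_re_le_norm m).trans h2)
  have a6 : η * ω.re < 1 := by
    have := mul_exp_lt_one ω.re
    rw [h3, neg_sub]; linarith
  have hη : 0 < η := by rw [h3]; positivity
  nlinarith

/-! ### Biholomorphic embeddings -/

/-- `f` is injective on the open set `V` and strictly differentiable there with invertible
derivative, so that it maps `V` biholomorphically onto an open set. -/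
structure IsBiholEmbedding {E : Type*} [NormedAddCommGroup E] [NormedSpace ℂ E]
    (f : E → E) (V : Set E) : Prop where
  isOpen : IsOpen V
  injOn : Set.InjOn f V
  strict : ∀ z ∈ V, ∃ f' : E ≃L[ℂ] E, HasStrictFDerivAt f (f' : E →L[ℂ] E) z

namespace IsBiholEmbedding

open Metric Topology

variable {E : Type*} [NormedAddCommGroup E] [NormedSpace ℂ E] {f g : E → E} {V W : Set E}

lemma differentiableOn (hf : IsBiholEmbedding f V) : DifferentiableOn ℂ f V := fun z hz => by
  obtain ⟨f', h⟩ := hf.strict z hz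
  exact h.hasFDerivAt.differentiableAt.differentiableWithinAt

lemma continuousOn (hf : IsBiholEmbedding f V) : ContinuousOn f V := hf.differentiableOn.continuousOn

protected lemma id : IsBiholEmbedding (id : E → E) Set.univ where
  isOpen := isOpen_univ
  injOn := Function.injective_id.injOn
  strict z _ := ⟨ContinuousLinearEquiv.refl ℂ E, hasStrictFDerivAt_id z⟩

lemma comp (hf : IsBiholEmbedding f V) (hg : IsBiholEmbedding g W) :
    IsBiholEmbedding (f ∘ g) (W ∩ g ⁻¹' V) where
  isOpen := hg.continuousOn.isOpen_inter_preimage hg.isOpen hf.isOpen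
  injOn x hx y hy h := hg.injOn hx.1 hy.1 (hf.injOn hx.2 hy.2 h)
  strict z hz := by
    obtain ⟨g', h1⟩ := hg.strict z hz.1
    obtain ⟨f', h2⟩ := hf.strict (g z) hz.2
    exact ⟨g'.trans f', h2.comp z h1⟩

/-- Conjugation by a linear isometry. -/
lemma conj (hf : IsBiholEmbedding f V) (U : E ≃ₗᵢ[ℂ] E) :
    IsBiholEmbedding (fun z => U (f (U.symm z))) (U.symm ⁻¹' V) where
  isOpen := hf.isOpen.preimage U.symm.continuous
  injOn x hx y hy h := U.symm.injective (hf.injOn hx hy (U.injective h))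
  strict z hz := by
    obtain ⟨f', h1⟩ := hf.strict (U.symm z) hz
    refine ⟨(U.symm.toContinuousLinearEquiv.trans f').trans U.toContinuousLinearEquiv, ?_⟩
    exact (U.toContinuousLinearEquiv.hasStrictFDerivAt).comp z
      (h1.comp z U.symm.toContinuousLinearEquiv.hasStrictFDerivAt)

/-- Uniform continuity near a compact subset of the domain. -/
lemma exists_modulus (hf : IsBiholEmbedding f V) {K : Set E} (hK : IsCompact K) (hKV : K ⊆ V)
    {η : ℝ} (hη : 0 < η) :
    ∃ δ > 0, ∀ x ∈ K, ∀ y, ‖y - x‖ < δ → y ∈ V ∧ ‖f y - f x‖ < η := by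
  obtain ⟨r, hr, hrV⟩ := hK.exists_thickening_subset_open hf.isOpen hKV
  have hunif := hK.uniformContinuousAt_of_continuousAt f
    (fun y hy => hf.continuousOn.continuousAt (hf.isOpen.mem_nhds (hKV hy)))
    (Metric.dist_mem_uniformity hη)
  obtain ⟨s, hs, hsf⟩ := Metric.mem_uniformity_dist.1 hunif
  refine ⟨min r s, by positivity, fun x hx y hy => ⟨?_, ?_⟩⟩
  · exact hrV (Metric.mem_thickening_iff.2 ⟨x, hx, by
      rw [dist_eq_norm]; exact hy.trans_le (min_le_left _ _)⟩)
  · have h : dist (f x) (f y) < η := hsf (by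
      rw [dist_comm, dist_eq_norm]; exact hy.trans_le (min_le_right _ _)) hx
    rwa [dist_comm, dist_eq_norm] at h

variable [CompleteSpace E]

lemma map_nhds_eq (hf : IsBiholEmbedding f V) {z : E} (hz : z ∈ V) :
    Filter.map f (𝓝 z) = 𝓝 (f z) := by
  obtain ⟨f', h⟩ := hf.strict z hz
  exact h.map_nhds_eq_of_equiv

lemma isOpen_image (hf : IsBiholEmbedding f V) : IsOpen (f '' V) := by
  rw [isOpen_iff_mem_nhds]
  rintro _ ⟨z, hz, rfl⟩
  rw [← hf.map_nhds_eq hz]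
  exact Filter.image_mem_map (hf.isOpen.mem_nhds hz)

/-- The inverse of a biholomorphic embedding is holomorphic. -/
lemma exists_inverse (hf : IsBiholEmbedding f V) :
    ∃ g : E → E, DifferentiableOn ℂ g (f '' V) ∧ ∀ z ∈ V, g (f z) = z := by
  have hg : ∀ z ∈ V, Function.invFunOn f V (f z) = z := fun z hz => hf.injOn.leftInvOn_invFunOn hz
  refine ⟨Function.invFunOn f V, ?_, hg⟩
  rintro _ ⟨z, hz, rfl⟩
  obtain ⟨f', h⟩ := hf.strict z hz
  refine DifferentiableAt.differentiableWithinAt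
    (HasFDerivAt.of_local_left_inverse (f := f) (f' := f') ?_ ?_ ?_).differentiableAt
  · rw [ContinuousAt, hg z hz, ← hf.map_nhds_eq hz, Filter.tendsto_map'_iff]
    refine Filter.Tendsto.congr' ?_ Filter.tendsto_id
    filter_upwards [hf.isOpen.mem_nhds hz] with x hx using (hg x hx).symm
  · rw [hg z hz]; exact h.hasFDerivAt
  · filter_upwards [hf.isOpen_image.mem_nhds ⟨z, hz, rfl⟩] with y hy
    obtain ⟨x, hx, rfl⟩ := hy
    rw [hg x hx]

/-- Points close to the image of a compact set under a biholomorphic embedding are images of points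
close to that compact set, uniformly. -/
lemma exists_tolerance (hf : IsBiholEmbedding f V) {K : Set E} (hK : IsCompact K) (hKV : K ⊆ V)
    {η : ℝ} (hη : 0 < η) :
    ∃ τ > 0, ∀ x ∈ K, ∀ y, ‖y - f x‖ ≤ τ → ∃ x' ∈ V, f x' = y ∧ ‖x' - x‖ < η := by
  obtain ⟨g, hg, hgf⟩ := hf.exists_inverse
  have hO := hf.isOpen_image
  have hfK : IsCompact (f '' K) := hK.image_of_continuousOn (hf.continuousOn.mono hKV)
  have hfKV : f '' K ⊆ f '' V := Set.image_mono hKV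
  obtain ⟨r, hr, hrV⟩ := hfK.exists_thickening_subset_open hO hfKV
  have hunif := hfK.uniformContinuousAt_of_continuousAt g
    (fun y hy => hg.continuousOn.continuousAt (hO.mem_nhds (hfKV hy))) (Metric.dist_mem_uniformity hη)
  obtain ⟨s, hs, hsg⟩ := Metric.mem_uniformity_dist.1 hunif
  refine ⟨min (r / 2) (s / 2), by positivity, fun x hx y hy => ?_⟩
  have h1 : dist y (f x) < r := by
    rw [dist_eq_norm]; linarith [min_le_left (r / 2) (s / 2)]
  have h2 : dist (f x) y < s := by
    rw [dist_comm, dist_eq_norm]; linarith [min_le_right (r / 2) (s / 2)]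
  obtain ⟨x', hx', rfl⟩ := hrV (Metric.mem_thickening_iff.2 ⟨f x, ⟨x, hx, rfl⟩, h1⟩)
  have h3 : dist (g (f x)) (g (f x')) < η := hsg h2 ⟨x, hx, rfl⟩
  rw [hgf x' hx', hgf x (hKV hx), dist_comm, dist_eq_norm] at h3
  exact ⟨x', hx', rfl, h3⟩

end IsBiholEmbedding

/-- A locally uniform limit of holomorphic maps on the unit ball is holomorphic. -/
lemma differentiableOn_ball_of_uniform_limit {E : Type*} [NormedAddCommGroup E] [NormedSpace ℂ E]
    [CompleteSpace E] {f : ℕ → E → E} {φ : E → E} {τ : ℕ → ℝ}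
    (hτ : Filter.Tendsto τ Filter.atTop (nhds 0))
    (hf : ∀ n, DifferentiableOn ℂ (f n) (Metric.ball 0 1))
    (hφ : ∀ n, ∀ z ∈ Metric.ball (0 : E) 1, ‖φ z - f n z‖ ≤ τ n) :
    DifferentiableOn ℂ φ (Metric.ball 0 1) := by
  have hconv : ∀ z ∈ Metric.ball (0 : E) 1,
      Filter.Tendsto (fun n => f n z) Filter.atTop (nhds (φ z)) := fun z hz => by
    rw [tendsto_iff_norm_sub_tendsto_zero]
    refine squeeze_zero (fun _ => norm_nonneg _) (fun n => ?_) hτ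
    rw [norm_sub_rev]; exact hφ n z hz
  intro x hx
  set r := (1 - ‖x‖) / 2 with hr
  have hr0 : 0 < r := by rw [mem_ball_zero_iff] at hx; rw [hr]; linarith
  have hsub : ∀ y ∈ Metric.ball x r, Metric.ball y r ⊆ Metric.ball 0 1 := by
    intro y hy z hz
    rw [Metric.mem_ball, dist_eq_norm] at hy hz
    rw [mem_ball_zero_iff]
    calc ‖z‖ = ‖(z - y) + (y - x) + x‖ := by congr 1; abel
      _ ≤ ‖z - y‖ + ‖y - x‖ + ‖x‖ := norm_add₃_le
      _ < 1 := by rw [hr] at hy hz; linarith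
  have hmem : ∀ y ∈ Metric.ball x r, y ∈ Metric.ball (0 : E) 1 := fun y hy =>
    hsub y hy (Metric.mem_ball_self hr0)
  have hd : ∀ n, ∀ y ∈ Metric.ball x r, DifferentiableAt ℂ (f n) y := fun n y hy =>
    (hf n).differentiableAt (Metric.isOpen_ball.mem_nhds (hmem y hy))
  -- Cauchy estimates: the derivatives converge uniformly on a smaller ball
  have hCauchy : ∀ m n, ∀ y ∈ Metric.ball x r,
      ‖fderiv ℂ (f m) y - fderiv ℂ (f n) y‖ ≤ 2 * (τ m + τ n) / r := by
    intro m n y hy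
    rw [← fderiv_sub (hd m y hy) (hd n y hy)]
    refine Complex.norm_fderiv_le_div_of_mapsTo_ball
      (((hf m).sub (hf n)).mono (hsub y hy)) (fun z hz => ?_) hr0
    have key : ∀ z ∈ Metric.ball (0 : E) 1, ‖f m z - f n z‖ ≤ τ m + τ n := fun z hz => by
      calc ‖f m z - f n z‖ = ‖(φ z - f n z) - (φ z - f m z)‖ := by congr 1; abel
        _ ≤ _ := norm_sub_le _ _
        _ ≤ _ := by linarith [hφ n z hz, hφ m z hz]
    rw [Metric.mem_closedBall, dist_eq_norm]
    refine (norm_sub_le _ _).trans ?_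
    have h1 := key z (hsub y hy hz)
    have h2 := key y (hmem y hy)
    simp only [Pi.sub_apply]
    linarith
  have hlim0 : ∀ ε > 0, ∃ M, ∀ m ≥ M, ∀ n ≥ M, 2 * (τ m + τ n) / r < ε := by
    intro ε hε
    obtain ⟨M, hM⟩ := Filter.eventually_atTop.1 (hτ.eventually (gt_mem_nhds
      (show (0 : ℝ) < ε * r / 4 by positivity)))
    refine ⟨M, fun m hm n hn => ?_⟩
    rw [div_lt_iff₀ hr0]
    linarith [hM m hm, hM n hn]
  have hUC : UniformCauchySeqOn (fun n => fderiv ℂ (f n)) Filter.atTop (Metric.ball x r) := by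
    rw [Metric.uniformCauchySeqOn_iff]
    intro ε hε
    obtain ⟨M, hM⟩ := hlim0 ε hε
    exact ⟨M, fun m hm n hn y hy => by
      rw [dist_eq_norm]; exact (hCauchy m n y hy).trans_lt (hM m hm n hn)⟩
  have hex : ∀ y ∈ Metric.ball x r, ∃ L : E →L[ℂ] E,
      Filter.Tendsto (fun n => fderiv ℂ (f n) y) Filter.atTop (nhds L) := fun y hy =>
    cauchySeq_tendsto_of_complete (hUC.cauchySeq hy)
  choose! L hL using hex
  have := hasFDerivAt_of_tendstoUniformlyOn Metric.isOpen_ball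
    (hUC.tendstoUniformlyOn_of_tendsto hL) (fun n y hy => (hd n y hy).hasFDerivAt)
    (fun y hy => hconv y (hmem y hy)) (Metric.mem_ball_self hr0)
  exact this.differentiableAt.differentiableWithinAt

/-! ### The finger map -/

/-- Shift of the depth, which makes the model estimates available on a ball of radius slightly
larger than one. -/
noncomputable def depthShift : ℝ := 1 / (2 * 10 ^ 6)

/-- Rescaled depth below the pole, as a function of the third coordinate. -/
noncomputable def depth (N : ℝ) (w : ℂ) : ℂ := N * (1 - w) + depthShift

/-- The height of a point of `ℂ³` in the rescaled coordinates. -/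
noncomputable def height (N : ℝ) (z : EuclideanSpace ℂ (Fin 3)) : ℂ :=
  fingerHeight (depth N (z 2)) (N * (z 0 * z 1))

/-- The entire function `(e^x - 1) / x`. -/
noncomputable def expQuot (x : ℂ) : ℂ := dslope Complex.exp 0 x

lemma mul_expQuot (x : ℂ) : x * expQuot x = Complex.exp x - 1 := by
  have := sub_smul_dslope Complex.exp 0 x
  simpa [expQuot] using this

lemma expQuot_zero : expQuot 0 = 1 := by simp [expQuot, dslope_same]

lemma differentiable_expQuot : Differentiable ℂ expQuot := by
  have := (Complex.differentiableOn_dslope (f := Complex.exp) (s := Set.univ) (c := 0)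
    Filter.univ_mem).2 Complex.differentiable_exp.differentiableOn
  exact differentiableOn_univ.1 this

lemma norm_expQuot_sub_one_le (x : ℂ) : ‖expQuot x - 1‖ ≤ ‖x‖ * Real.exp ‖x‖ := by
  rcases eq_or_ne x 0 with rfl | hx
  · simp [expQuot_zero]
  · have h := Complex.norm_exp_sub_sum_le_norm_mul_exp x 2
    have h2 : Complex.exp x - ∑ m ∈ Finset.range 2, x ^ m / m.factorial = x * (expQuot x - 1) := by
      rw [mul_sub, mul_expQuot]; simp [Finset.sum_range_succ]; ring
    rw [h2, norm_mul, sq, mul_assoc] at h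
    exact le_of_mul_le_mul_left h (norm_pos_iff.2 hx)

/-- The exponent of the twist. -/
noncomputable def twist (N : ℝ) (z : EuclideanSpace ℂ (Fin 3)) : ℂ :=
  2 * Real.pi * Complex.I * gate (height N z) * (N * (z 0 * z 1))

/-- The finger map at the pole `(0, 0, 1)`. The third coordinate pushes out a finger. Where
`z 0 ≠ 0`, the second coordinate is `(e^{L z 1} - 1) / L` with `L * z 1 = twist N z`, where `L` depends
on `z 0` and the height alone; it is close to `z 1` outside the tip of the finger. -/
noncomputable def fingerMap (N : ℝ) (z : EuclideanSpace ℂ (Fin 3)) : EuclideanSpace ℂ (Fin 3) :=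
  !₂[z 0, z 1 * expQuot (twist N z), 1 + (depthShift - height N z) / N]

/-- A ball slightly larger than the unit ball, on which the finger map is injective. -/
def fingerDomain (N : ℝ) : Set (EuclideanSpace ℂ (Fin 3)) := {z | ‖z‖ ^ 2 < 1 + 2 * depthShift / N}

lemma depthShift_pos : 0 < depthShift := by norm_num [depthShift]

lemma isOpen_fingerDomain (N : ℝ) : IsOpen (fingerDomain N) :=
  isOpen_lt (by fun_prop) continuous_const

lemma closedBall_subset_fingerDomain {N : ℝ} (hN : 0 < N) :
    Metric.closedBall 0 1 ⊆ fingerDomain N := fun z hz => by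
  rw [mem_closedBall_zero_iff] at hz
  have := depthShift_pos
  have h : 0 < 2 * depthShift / N := by positivity
  show ‖z‖ ^ 2 < _
  nlinarith [norm_nonneg z]

lemma norm_sq_fin_three (z : EuclideanSpace ℂ (Fin 3)) :
    ‖z‖ ^ 2 = ‖z 0‖ ^ 2 + ‖z 1‖ ^ 2 + ‖z 2‖ ^ 2 := by
  rw [EuclideanSpace.norm_sq_eq, Fin.sum_univ_three]

lemma re_depth (N : ℝ) (w : ℂ) : (depth N w).re = N * (1 - w.re) + depthShift := by
  simp [depth]

lemma mul_norm_sq_le_re_depth {N : ℝ} (hN : 0 < N) {z : EuclideanSpace ℂ (Fin 3)}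
    (hz : z ∈ fingerDomain N) : N * (‖z 0‖ ^ 2 + ‖z 1‖ ^ 2) ≤ 2 * (depth N (z 2)).re := by
  have h : ‖z‖ ^ 2 < 1 + 2 * depthShift / N := hz
  rw [norm_sq_fin_three] at h
  rw [re_depth]
  have h1 : N * (‖z 0‖ ^ 2 + ‖z 1‖ ^ 2 + ‖z 2‖ ^ 2) < N * (1 + 2 * depthShift / N) :=
    mul_lt_mul_of_pos_left h hN
  have h2 : N * (1 + 2 * depthShift / N) = N + 2 * depthShift := by field_simp
  have h3 : 2 * (z 2).re ≤ 1 + ‖z 2‖ ^ 2 := by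
    nlinarith [Complex.re_le_norm (z 2), sq_nonneg (1 - ‖z 2‖)]
  nlinarith

lemma norm_level_le {N : ℝ} (hN : 0 < N) {z : EuclideanSpace ℂ (Fin 3)}
    (hz : z ∈ fingerDomain N) : ‖(N * (z 0 * z 1) : ℂ)‖ ≤ (depth N (z 2)).re := by
  have := mul_norm_sq_le_re_depth hN hz
  rw [norm_mul, norm_mul, Complex.norm_real, Real.norm_eq_abs, abs_of_pos hN]
  nlinarith [mul_nonneg hN.le (sq_nonneg (‖z 0‖ - ‖z 1‖))]

/-- Where the first and third coordinates of the images agree, equality of the second ones means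
that the two twists differ by a period, and `norm_gate_mul_sub_lt_one` excludes a nonzero one. -/
lemma fingerMap_injOn {N : ℝ} (hN : 0 < N) : Set.InjOn (fingerMap N) (fingerDomain N) := by
  intro z hz z' hz' h
  have hN' : (N : ℂ) ≠ 0 := by exact_mod_cast hN.ne'
  have h0 : z 0 = z' 0 := by simpa [fingerMap] using congrArg (fun u => u 0) h
  have h1 : z 1 * expQuot (twist N z) = z' 1 * expQuot (twist N z') := by
    simpa [fingerMap] using congrArg (fun u => u 1) h
  have h2 : height N z = height N z' := by
    have : 1 + (depthShift - height N z) / N = 1 + (depthShift - height N z') / N :=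
      congrArg (fun u : EuclideanSpace ℂ (Fin 3) => u 2) h
    field_simp at this
    linear_combination -this
  have hg := norm_gate_mul_sub_lt_one (norm_level_le hN hz) (norm_level_le hN hz') h2
  change ‖gate (height N z) * _‖ < 1 at hg
  have h11 : z 1 = z' 1 := by
    set L : ℂ := 2 * Real.pi * Complex.I * gate (height N z) * (N * z 0) with hL
    have t1 : twist N z = L * z 1 := by rw [twist, hL]; ring
    have t2 : twist N z' = L * z' 1 := by rw [twist, ← h2, ← h0, hL]; ring
    by_cases hz0 : z 0 = 0
    · have : L = 0 := by simp [hL, hz0]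
      simpa [t1, t2, this, expQuot_zero] using h1
    · have hL0 : L ≠ 0 := by
        simp [hL, hz0, gate_ne_zero, hN.ne', Real.pi_ne_zero]
      have e : Complex.exp (L * z 1) = Complex.exp (L * z' 1) := by
        have e1 := mul_expQuot (L * z 1)
        have e2 := mul_expQuot (L * z' 1)
        rw [t1, t2] at h1
        linear_combination L * h1 - e1 + e2
      obtain ⟨n, hn⟩ := Complex.exp_eq_exp_iff_exists_int.1 e
      have hn' : gate (height N z) * (N * (z 0 * z 1) - N * (z' 0 * z' 1)) = n := by
        have : (2 * Real.pi * Complex.I : ℂ) ≠ 0 := Complex.two_pi_I_ne_zero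
        apply mul_left_cancel₀ this
        rw [← h0]
        rw [hL] at hn
        linear_combination hn
      rw [hn', Complex.norm_intCast] at hg
      have : n = 0 := by
        have : |n| < 1 := by exact_mod_cast hg
        exact Int.abs_lt_one_iff.1 this
      rw [this] at hn
      simpa [hL0] using hn
  have h22 : z 2 = z' 2 := by
    have hl := norm_level_le hN hz'
    rw [← h0, ← h11] at hl
    have : depth N (z 2) = depth N (z' 2) := by
      refine fingerHeight_injective (norm_level_le hN hz) hl ?_
      simpa only [height, ← h0, ← h11] using h2
    simp only [depth] at this
    apply mul_left_cancel₀ hN'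
    linear_combination -this
  ext i
  fin_cases i
  · exact h0
  · exact h11
  · exact h22

lemma contDiff_height (N : ℝ) : ContDiff ℂ 1 (height N) := by
  unfold height fingerHeight depth
  fun_prop

lemma contDiff_fingerMap (N : ℝ) : ContDiff ℂ 1 (fingerMap N) := by
  have h1 := contDiff_height N
  have h2 : ContDiff ℂ 1 expQuot := differentiable_expQuot.contDiff
  have h3 : ContDiff ℂ 1 gate := by unfold gate; fun_prop
  have h4 : ContDiff ℂ 1 (twist N) := by unfold twist; fun_prop
  rw [contDiff_euclidean]
  intro i
  fin_cases i
  · show ContDiff ℂ 1 (fun z : EuclideanSpace ℂ (Fin 3) => z 0)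
    fun_prop
  · show ContDiff ℂ 1 (fun z : EuclideanSpace ℂ (Fin 3) => z 1 * expQuot (twist N z))
    fun_prop
  · show ContDiff ℂ 1 (fun z : EuclideanSpace ℂ (Fin 3) => 1 + (depthShift - height N z) / N)
    fun_prop

/-- The derivative is triangular in the coordinates `z 0`, height, `z 1`, with nonzero diagonal. -/
lemma fderiv_fingerMap_injective {N : ℝ} (hN : 0 < N) {z : EuclideanSpace ℂ (Fin 3)}
    (hz : z ∈ fingerDomain N) {v : EuclideanSpace ℂ (Fin 3)}
    (hv : fderiv ℂ (fingerMap N) z v = 0) : v = 0 := by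
  have hN' : (N : ℂ) ≠ 0 := by exact_mod_cast hN.ne'
  -- restrict to the complex line through `z` in direction `v`
  have hline : HasDerivAt (fun h : ℂ => z + h • v) v 0 := by
    simpa using ((hasDerivAt_id (0 : ℂ)).smul_const v).const_add z
  have hcurve : HasDerivAt (fun h : ℂ => fingerMap N (z + h • v)) 0 0 := by
    have hd : HasFDerivAt (fingerMap N) (fderiv ℂ (fingerMap N) z) (z + (0 : ℂ) • v) := by
      simpa using ((contDiff_fingerMap N).differentiable one_ne_zero z).hasFDerivAt
    have := hd.comp_hasDerivAt (0 : ℂ) hline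
    rwa [hv] at this
  have hcomp : ∀ i, HasDerivAt (fun h : ℂ => fingerMap N (z + h • v) i) 0 0 := fun i => by
    have := (EuclideanSpace.proj (𝕜 := ℂ) i).hasFDerivAt.comp_hasDerivAt (0 : ℂ) hcurve
    rwa [map_zero] at this
  have hcoord : ∀ i, HasDerivAt (fun h : ℂ => (z + h • v) i) (v i) 0 := fun i =>
    (EuclideanSpace.proj (𝕜 := ℂ) i).hasFDerivAt.comp_hasDerivAt (0 : ℂ) hline
  have v0 : v 0 = 0 := (hcoord 0).unique (hcomp 0)
  have hheight : HasDerivAt (fun h : ℂ => height N (z + h • v)) 0 0 := by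
    have h2 : HasDerivAt (fun h : ℂ => 1 + (depthShift - height N (z + h • v)) / N) 0 0 := hcomp 2
    have h3 := ((h2.sub_const 1).const_mul (N : ℂ)).const_sub (depthShift : ℂ)
    simp only [mul_zero, neg_zero] at h3
    refine h3.congr_of_eventuallyEq (Filter.Eventually.of_forall fun h => ?_)
    field_simp
    ring
  have hz0 : ∀ h : ℂ, (z + h • v) 0 = z 0 := fun h => by simp [v0]
  have v1 : v 1 = 0 := by
    have h1 : HasDerivAt (fun h : ℂ => (z + h • v) 1 * expQuot (twist N (z + h • v))) 0 0 := hcomp 1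
    by_cases hz00 : z 0 = 0
    · have : (fun h : ℂ => (z + h • v) 1 * expQuot (twist N (z + h • v))) =
          fun h => (z + h • v) 1 := by
        ext h
        rw [twist, hz0, hz00]; simp [expQuot_zero]
      rw [this] at h1
      exact (hcoord 1).unique h1
    · -- differentiate `L * (second coordinate of the image) = exp (L * z 1) - 1`
      set L : ℂ → ℂ := fun h => 2 * Real.pi * Complex.I * gate (height N (z + h • v)) * (N * z 0)
        with hL
      have hgate : Differentiable ℂ gate := by unfold gate; fun_prop
      have hLd : HasDerivAt L 0 0 := by
        have := (hgate (height N (z + (0 : ℂ) • v))).hasDerivAt.comp (0 : ℂ) hheight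
        have := (this.const_mul (2 * Real.pi * Complex.I : ℂ)).mul_const (N * z 0 : ℂ)
        simpa using this
      have e1 := hLd.mul h1
      have e2 := ((hLd.mul (hcoord 1)).cexp).sub_const 1
      have e3 : (fun h => Complex.exp ((L * fun h : ℂ => (z + h • v) 1) h) - 1) =
          L * fun h : ℂ => (z + h • v) 1 * expQuot (twist N (z + h • v)) := by
        ext h
        have : twist N (z + h • v) = L h * (z + h • v) 1 := by
          simp only [twist, hL, hz0]; ring
        simp only [Pi.mul_apply]
        rw [this, ← mul_assoc, mul_expQuot]
      rw [e3] at e2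
      have := e2.unique e1
      have hL0 : L 0 ≠ 0 := by
        simp [hL, hz00, gate_ne_zero, hN.ne', Real.pi_ne_zero]
      simpa [Complex.exp_ne_zero, hL0] using this
  have v2 : v 2 = 0 := by
    have hz1 : ∀ h : ℂ, (z + h • v) 1 = z 1 := fun h => by simp [v1]
    have hdep : HasDerivAt (fun h : ℂ => depth N ((z + h • v) 2)) (-(N * v 2)) 0 := by
      simpa [depth] using (((hcoord 2).const_sub 1).const_mul (N : ℂ)).add_const (depthShift : ℂ)
    have h1 := hdep.sub (((hdep.const_sub (1 / 3)).cexp.const_mul (3 / 2)).mul_const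
      (N * (z 0 * z 1) : ℂ))
    have h2 := h1.congr_of_eventuallyEq (f₁ := fun h : ℂ => height N (z + h • v))
      (Filter.Eventually.of_forall fun h => by
        simp only [height, hz0, hz1, fingerHeight, Pi.sub_apply])
    have h3 := h2.unique hheight
    have h4 := one_add_exp_mul_ne_zero (norm_level_le hN hz)
    have h5 : (N * v 2) *
        (1 + 3 / 2 * Complex.exp (1 / 3 - depth N (z 2)) * (N * (z 0 * z 1))) = 0 := by
      simp only [zero_smul, add_zero] at h3
      linear_combination -h3
    have := (mul_eq_zero.1 h5).resolve_right h4
    exact (mul_eq_zero.1 this).resolve_left hN'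
  ext i
  fin_cases i
  · exact v0
  · exact v1
  · exact v2

lemma isBiholEmbedding_fingerMap {N : ℝ} (hN : 0 < N) :
    IsBiholEmbedding (fingerMap N) (fingerDomain N) where
  isOpen := isOpen_fingerDomain N
  injOn := fingerMap_injOn hN
  strict z hz := by
    have hinj : Function.Injective (fderiv ℂ (fingerMap N) z).toLinearMap :=
      (injective_iff_map_eq_zero _).2 fun v hv => fderiv_fingerMap_injective hN hz hv
    refine ⟨(LinearEquiv.ofInjectiveEndo _ hinj).toContinuousLinearEquiv, ?_⟩
    have h := (contDiff_fingerMap N).contDiffAt.hasStrictFDerivAt (x := z) one_ne_zero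
    convert h using 1
    ext v : 1
    rfl

lemma norm_fin_three_le (z : EuclideanSpace ℂ (Fin 3)) : ‖z‖ ≤ ‖z 0‖ + ‖z 1‖ + ‖z 2‖ := by
  apply le_of_sq_le_sq _ (by positivity)
  rw [norm_sq_fin_three]
  nlinarith [mul_nonneg (norm_nonneg (z 0)) (norm_nonneg (z 1)),
    mul_nonneg (norm_nonneg (z 0)) (norm_nonneg (z 2)),
    mul_nonneg (norm_nonneg (z 1)) (norm_nonneg (z 2))]

/-- The twist decays fast enough with the depth to be bounded independently of the scale `N`. -/
lemma exists_bound_twist :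
    ∃ B > 0, ∀ N > 0, ∀ z ∈ fingerDomain N, (1 + (depth N (z 2)).re) * ‖twist N z‖ ≤ B := by
  refine ⟨2 * Real.pi * (18 / 5) * (2 * Real.exp (7 / 3)), by positivity, fun N hN z hz => ?_⟩
  have hl := norm_level_le hN hz
  have h0 : 0 ≤ (height N z).re + 1 / 6 := fingerHeight_re_nonneg hl
  have h1 : (depth N (z 2)).re ≤ (height N z).re + 1 / 6 + 4 / 3 := re_le_fingerHeight hl
  have hg := norm_gate_le (height N z)
  have hx0 : 0 ≤ (depth N (z 2)).re := (norm_nonneg _).trans hl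
  set e := (height N z).re + 1 / 6
  set x := (depth N (z 2)).re
  have ht : ‖twist N z‖ ≤ 2 * Real.pi * (18 / 5 * Real.exp (-e)) * x := by
    rw [twist, norm_mul, norm_mul]
    have : ‖(2 * Real.pi * Complex.I : ℂ)‖ = 2 * Real.pi := by
      simp [abs_of_pos Real.pi_pos]
    rw [this]
    have hexp : Real.exp (-(10 ^ 5 * e)) ≤ Real.exp (-e) := Real.exp_le_exp.2 (by nlinarith)
    gcongr
    exact hg.trans (by gcongr)
  have hq := Real.quadratic_le_exp_of_nonneg (show 0 ≤ e + 7 / 3 by linarith)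
  have he : Real.exp (e + 7 / 3) * Real.exp (-e) = Real.exp (7 / 3) := by
    rw [← Real.exp_add]; ring_nf
  have hxx : (1 + x) * x ≤ 2 * Real.exp (e + 7 / 3) := by nlinarith
  calc (1 + x) * ‖twist N z‖ ≤ (1 + x) * (2 * Real.pi * (18 / 5 * Real.exp (-e)) * x) := by gcongr
    _ = 2 * Real.pi * (18 / 5) * (((1 + x) * x) * Real.exp (-e)) := by ring
    _ ≤ 2 * Real.pi * (18 / 5) * ((2 * Real.exp (e + 7 / 3)) * Real.exp (-e)) := by gcongr
    _ = _ := by rw [mul_assoc 2 (Real.exp _), he]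

/-- The finger map converges to the identity as the scale parameter tends to infinity. -/
lemma exists_norm_fingerMap_sub_le :
    ∃ C > 0, ∀ N ≥ 1, ∀ z ∈ fingerDomain N, ‖fingerMap N z - z‖ ≤ C / Real.sqrt N := by
  obtain ⟨B, hB, hBt⟩ := exists_bound_twist
  refine ⟨2 * B * Real.exp B + 1, by positivity, fun N hN1 z hz => ?_⟩
  have hN : 0 < N := by linarith
  have hN' : (N : ℂ) ≠ 0 := by exact_mod_cast hN.ne'
  have hl := norm_level_le hN hz
  have hx0 : 0 ≤ (depth N (z 2)).re := (norm_nonneg _).trans hl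
  have hs : 0 < Real.sqrt N := Real.sqrt_pos.2 hN
  have hss : Real.sqrt N * Real.sqrt N = N := Real.mul_self_sqrt hN.le
  have hs1 : 1 ≤ Real.sqrt N := Real.one_le_sqrt.2 hN1
  have hb := hBt N hN z hz
  have c1 : ‖z 1 * expQuot (twist N z) - z 1‖ ≤ 2 * B * Real.exp B / Real.sqrt N := by
    have hq := mul_norm_sq_le_re_depth hN hz
    have hz1 : ‖z 1‖ ≤ 2 * (1 + (depth N (z 2)).re) / Real.sqrt N := by
      rw [le_div_iff₀ hs]
      apply le_of_sq_le_sq _ (by positivity)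
      rw [mul_pow, sq (Real.sqrt N), hss]
      nlinarith [mul_nonneg hN.le (sq_nonneg ‖z 0‖)]
    have htB : ‖twist N z‖ ≤ B := by nlinarith [norm_nonneg (twist N z)]
    have he : z 1 * expQuot (twist N z) - z 1 = z 1 * (expQuot (twist N z) - 1) := by ring
    rw [he, norm_mul]
    calc ‖z 1‖ * ‖expQuot (twist N z) - 1‖
        ≤ (2 * (1 + (depth N (z 2)).re) / Real.sqrt N) * (‖twist N z‖ * Real.exp ‖twist N z‖) := by
          gcongr; exact norm_expQuot_sub_one_le _
      _ = 2 * ((1 + (depth N (z 2)).re) * ‖twist N z‖) * Real.exp ‖twist N z‖ / Real.sqrt N := by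
          ring
      _ ≤ _ := by gcongr
  have c2 : ‖1 + (depthShift - height N z) / N - z 2‖ ≤ 1 / Real.sqrt N := by
    have he : 1 + (depthShift - height N z) / N - z 2 =
        3 / 2 * Complex.exp (1 / 3 - depth N (z 2)) * (N * (z 0 * z 1)) / N := by
      have : (z 2 : ℂ) = 1 + (depthShift - depth N (z 2)) / N := by
        rw [depth]; field_simp; ring
      conv_lhs => rw [this, height, fingerHeight]
      ring
    rw [he, norm_div, norm_mul, norm_mul, Complex.norm_exp, Complex.norm_real, Real.norm_eq_abs,
      abs_of_pos hN]
    have h1 : ‖(3 / 2 : ℂ)‖ = 3 / 2 := by norm_num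
    have h2 : (1 / 3 - depth N (z 2)).re = 1 / 3 - (depth N (z 2)).re := by
      have : (1 / 3 : ℂ) = ((1 / 3 : ℝ) : ℂ) := by push_cast; rfl
      rw [Complex.sub_re, this, Complex.ofReal_re]
    rw [h1, h2]
    have h3 := mul_exp_lt_one (depth N (z 2)).re
    have h4 : 3 / 2 * Real.exp (1 / 3 - (depth N (z 2)).re) * ‖(N * (z 0 * z 1) : ℂ)‖ ≤ 1 := by
      calc _ ≤ 3 / 2 * Real.exp (1 / 3 - (depth N (z 2)).re) * (depth N (z 2)).re := by gcongr
        _ ≤ 1 := by linarith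
    calc _ ≤ 1 / N := by gcongr
      _ ≤ 1 / Real.sqrt N := by gcongr; nlinarith
  have h := norm_fin_three_le (fingerMap N z - z)
  have e0 : (fingerMap N z - z) 0 = 0 := sub_self (z 0)
  have e1 : (fingerMap N z - z) 1 = z 1 * expQuot (twist N z) - z 1 := rfl
  have e2 : (fingerMap N z - z) 2 = 1 + (depthShift - height N z) / N - z 2 := rfl
  rw [e0, e1, e2, norm_zero, zero_add] at h
  calc _ ≤ _ := h
    _ ≤ 2 * B * Real.exp B / Real.sqrt N + 1 / Real.sqrt N := add_le_add c1 c2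
    _ = _ := by ring

/-- The circle in the ball that the finger map sends to the boundary of a flat disc. It lies in
the totally real disc where the first two coordinates are conjugate. -/
noncomputable def fingerCircle (N : ℝ) (ζ : ℂ) : EuclideanSpace ℂ (Fin 3) :=
  !₂[Real.sqrt (circleLevel / N) * ζ, Real.sqrt (circleLevel / N) * ζ⁻¹,
    1 - (1 / 3 - depthShift) / N]

/-- The flat disc bounded by the image of the circle. -/
noncomputable def fingerDisc (N : ℝ) (ζ : ℂ) : EuclideanSpace ℂ (Fin 3) :=
  !₂[Real.sqrt (circleLevel / N) * ζ, 0,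
    1 + (depthShift - fingerHeight (1 / 3) circleLevel) / N]

/-- On the circle the twist equals `2πi`, where `expQuot` vanishes. -/
lemma fingerMap_fingerCircle {N : ℝ} (hN : 0 < N) {ζ : ℂ} (hζ : ‖ζ‖ = 1) :
    fingerMap N (fingerCircle N ζ) = fingerDisc N ζ := by
  have hN' : (N : ℂ) ≠ 0 := by exact_mod_cast hN.ne'
  have hζ0 : ζ ≠ 0 := norm_ne_zero_iff.1 (by rw [hζ]; exact one_ne_zero)
  have c0 : fingerCircle N ζ 0 = Real.sqrt (circleLevel / N) * ζ := rfl
  have c1 : fingerCircle N ζ 1 = Real.sqrt (circleLevel / N) * ζ⁻¹ := rfl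
  have c2 : fingerCircle N ζ 2 = 1 - (1 / 3 - depthShift) / N := rfl
  have hsq : ((Real.sqrt (circleLevel / N) : ℝ) : ℂ) * (Real.sqrt (circleLevel / N) : ℝ) =
      circleLevel / N := by
    have := Real.mul_self_sqrt (div_nonneg circleLevel_pos.le hN.le)
    exact_mod_cast this
  have hlev : (N * (fingerCircle N ζ 0 * fingerCircle N ζ 1) : ℂ) = circleLevel := by
    rw [c0, c1]
    calc _ = N * (((Real.sqrt (circleLevel / N) : ℝ) : ℂ) * (Real.sqrt (circleLevel / N) : ℝ)) *
          (ζ * ζ⁻¹) := by ring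
      _ = _ := by rw [hsq, mul_inv_cancel₀ hζ0]; field_simp
  have hdep : depth N (fingerCircle N ζ 2) = 1 / 3 := by
    rw [c2, depth]; field_simp; ring
  have hh : height N (fingerCircle N ζ) = fingerHeight (1 / 3) circleLevel := by
    rw [height, hdep, hlev]
  have ht : twist N (fingerCircle N ζ) = 2 * Real.pi * Complex.I := by
    rw [twist, hh, hlev, mul_assoc, gate_circle, mul_one]
  have hE : expQuot (2 * Real.pi * Complex.I) = 0 := by
    have := mul_expQuot (2 * Real.pi * Complex.I)
    rw [Complex.exp_two_pi_mul_I, sub_self] at this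
    exact (mul_eq_zero.1 this).resolve_left Complex.two_pi_I_ne_zero
  rw [fingerMap, ht, hE, hh, mul_zero, c0, fingerDisc]

lemma norm_fingerCircle_lt {N : ℝ} (hN : 10 ^ 6 ≤ N) :
    ∃ r < 1, ∀ ζ : ℂ, ‖ζ‖ = 1 → ‖fingerCircle N ζ‖ ≤ r := by
  have hN0 : 0 < N := by linarith
  have hlt : 2 * (circleLevel / N) + (1 - (1 / 3 - depthShift) / N) ^ 2 < 1 := by
    have h1 : (1 / 3 - depthShift) ^ 2 / N ≤ 1 / 9 / 10 ^ 6 := by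
      rw [div_le_div_iff₀ hN0 (by norm_num)]
      have : (1 / 3 - depthShift) ^ 2 ≤ 1 / 9 := by norm_num [depthShift]
      nlinarith
    have h2 : 2 * (circleLevel / N) + (1 - (1 / 3 - depthShift) / N) ^ 2 =
        1 + (2 * (circleLevel - 1 / 3 + depthShift) + (1 / 3 - depthShift) ^ 2 / N) / N := by
      field_simp; ring
    rw [h2]
    have h3 : 2 * (circleLevel - 1 / 3 + depthShift) + (1 / 3 - depthShift) ^ 2 / N < 0 := by
      have : circleLevel - 1 / 3 + depthShift = -(1 / (2 * 10 ^ 6)) := by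
        norm_num [circleLevel, depthShift]
      rw [this]; linarith
    have := div_neg_of_neg_of_pos h3 hN0
    linarith
  refine ⟨Real.sqrt (2 * (circleLevel / N) + (1 - (1 / 3 - depthShift) / N) ^ 2),
    (Real.sqrt_lt' one_pos).2 (by simpa using hlt), fun ζ hζ => Real.le_sqrt_of_sq_le ?_⟩
  have hs := Real.sq_sqrt (div_nonneg circleLevel_pos.le hN0.le)
  have c0 : fingerCircle N ζ 0 = Real.sqrt (circleLevel / N) * ζ := rfl
  have c1 : fingerCircle N ζ 1 = Real.sqrt (circleLevel / N) * ζ⁻¹ := rfl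
  have c2 : fingerCircle N ζ 2 = ((1 - (1 / 3 - depthShift) / N : ℝ) : ℂ) := by
    push_cast; rfl
  rw [norm_sq_fin_three, c0, c1, c2, norm_mul, norm_mul, norm_inv, hζ, Complex.norm_real,
    Complex.norm_real, Real.norm_eq_abs, Real.norm_eq_abs, inv_one, mul_one, sq_abs, sq_abs, hs]
  linarith

lemma norm_fingerDisc_sub_le {N : ℝ} (hN : 1 ≤ N) {ζ : ℂ} (hζ : ‖ζ‖ ≤ 1) :
    ‖fingerDisc N ζ - EuclideanSpace.single 2 1‖ ≤ 2 / Real.sqrt N := by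
  have hN0 : 0 < N := by linarith
  have hs : 0 < Real.sqrt N := Real.sqrt_pos.2 hN0
  have hss : Real.sqrt N * Real.sqrt N = N := Real.mul_self_sqrt hN0.le
  have hs1 : 1 ≤ Real.sqrt N := Real.one_le_sqrt.2 hN
  have h := norm_fin_three_le (fingerDisc N ζ - EuclideanSpace.single 2 1)
  have e0 : (fingerDisc N ζ - EuclideanSpace.single 2 1 : EuclideanSpace ℂ (Fin 3)) 0 =
      Real.sqrt (circleLevel / N) * ζ := by
    simp [fingerDisc]
  have e1 : (fingerDisc N ζ - EuclideanSpace.single 2 1 : EuclideanSpace ℂ (Fin 3)) 1 = 0 := by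
    simp [fingerDisc]
  have e2 : (fingerDisc N ζ - EuclideanSpace.single 2 1 : EuclideanSpace ℂ (Fin 3)) 2 =
      (((depthShift + 1 / 6 - 3 / 2 * 1 / 10 ^ 6) / N : ℝ) : ℂ) := by
    rw [fingerDisc, fingerHeight_circle]; simp; ring
  rw [e0, e1, e2, norm_zero, add_zero, norm_mul, Complex.norm_real, Complex.norm_real,
    Real.norm_eq_abs, Real.norm_eq_abs, abs_of_nonneg (Real.sqrt_nonneg _)] at h
  have h1 : Real.sqrt (circleLevel / N) ≤ 1 / Real.sqrt N := by
    rw [Real.sqrt_div circleLevel_pos.le]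
    gcongr
    exact Real.sqrt_le_one.2 (by norm_num [circleLevel])
  have h2 : |(depthShift + 1 / 6 - 3 / 2 * 1 / 10 ^ 6) / N| ≤ 1 / Real.sqrt N := by
    rw [abs_div, abs_of_pos hN0]
    calc _ ≤ 1 / N := by
          gcongr
          rw [abs_le]; norm_num [depthShift]
      _ ≤ _ := by gcongr; nlinarith
  calc _ ≤ _ := h
    _ ≤ 1 / Real.sqrt N * 1 + 1 / Real.sqrt N := by gcongr
    _ = _ := by ring

/-- There is a linear isometry taking the pole to any given unit vector. -/
lemma exists_linearIsometryEquiv_single {q : EuclideanSpace ℂ (Fin 3)} (hq : ‖q‖ = 1) :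
    ∃ U : EuclideanSpace ℂ (Fin 3) ≃ₗᵢ[ℂ] EuclideanSpace ℂ (Fin 3),
      U (EuclideanSpace.single 2 1) = q := by
  have hv : Orthonormal ℂ (Set.domRestrict {(2 : Fin 3)} fun _ : Fin 3 => q) := by
    constructor
    · exact fun _ => hq
    · intro i j hij; exact absurd (Subsingleton.elim i j) hij
  obtain ⟨b, hb⟩ := hv.exists_orthonormalBasis_extension_of_card_eq
    (by simp : Module.finrank ℂ (EuclideanSpace ℂ (Fin 3)) = Fintype.card (Fin 3))
  refine ⟨b.repr.symm, ?_⟩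
  rw [b.repr_symm_single]
  exact hb 2 rfl

/-- A small perturbation of the identity near the closed ball, by a biholomorphic embedding `ψ`
that creates an obstruction close to `q`: a circle in the open ball on which the linear form `l`
is a multiple of `ζ⁻¹`, but whose image under `ψ` bounds a holomorphic disc close to `q`. -/
lemma exists_finger {q : EuclideanSpace ℂ (Fin 3)} (hq : ‖q‖ = 1) {δ : ℝ} (hδ : 0 < δ) :
    ∃ (ψ : EuclideanSpace ℂ (Fin 3) → EuclideanSpace ℂ (Fin 3)) (W : Set (EuclideanSpace ℂ (Fin 3)))
      (l : EuclideanSpace ℂ (Fin 3) →L[ℂ] ℂ) (κ d : ℂ → EuclideanSpace ℂ (Fin 3)) (ρ r : ℝ),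
      IsBiholEmbedding ψ W ∧ Metric.closedBall 0 1 ⊆ W ∧
      (∀ z ∈ Metric.closedBall 0 1, ‖ψ z - z‖ < δ) ∧
      0 < ρ ∧ r < 1 ∧ Differentiable ℂ d ∧ (∀ ζ, ‖ζ‖ ≤ 1 → ‖d ζ - q‖ < δ) ∧
      ∀ ζ, ‖ζ‖ = 1 → κ ζ ∈ Metric.closedBall 0 r ∧ ψ (κ ζ) = d ζ ∧ l (κ ζ) = ρ * ζ⁻¹ := by
  obtain ⟨U, hU⟩ := exists_linearIsometryEquiv_single hq
  obtain ⟨C, hC, hCb⟩ := exists_norm_fingerMap_sub_le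
  obtain ⟨N, hN1, hN2⟩ : ∃ N : ℝ, 10 ^ 6 ≤ N ∧ (C + 2) / Real.sqrt N < δ := by
    refine ⟨max (10 ^ 6) (((C + 2) / δ + 1) ^ 2), le_max_left _ _, ?_⟩
    have h1 : (C + 2) / δ + 1 ≤ Real.sqrt (max (10 ^ 6) (((C + 2) / δ + 1) ^ 2)) :=
      Real.le_sqrt_of_sq_le (le_max_right _ _)
    have h2 : 0 < (C + 2) / δ := by positivity
    rw [div_lt_comm₀ (by linarith) hδ]
    linarith
  have hN : 0 < N := by linarith
  have hs : 0 < Real.sqrt N := Real.sqrt_pos.2 hN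
  have hCδ : C / Real.sqrt N < δ := lt_of_le_of_lt (by gcongr; linarith) hN2
  have h2δ : 2 / Real.sqrt N < δ := lt_of_le_of_lt (by gcongr; linarith) hN2
  obtain ⟨r, hr1, hr⟩ := norm_fingerCircle_lt hN1
  refine ⟨fun z => U (fingerMap N (U.symm z)), U.symm ⁻¹' fingerDomain N,
    (EuclideanSpace.proj 1).comp U.symm.toContinuousLinearEquiv.toContinuousLinearMap,
    fun ζ => U (fingerCircle N ζ), fun ζ => U (fingerDisc N ζ), Real.sqrt (circleLevel / N), r,
    (isBiholEmbedding_fingerMap hN).conj U, ?_, ?_,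
    Real.sqrt_pos.2 (div_pos circleLevel_pos hN), hr1, ?_, ?_, ?_⟩
  · intro z hz
    exact closedBall_subset_fingerDomain hN (by simpa using hz)
  · intro z hz
    have h1 := hCb N (by linarith) (U.symm z)
      (closedBall_subset_fingerDomain hN (by simpa using hz))
    have h2 : U (fingerMap N (U.symm z)) - z = U (fingerMap N (U.symm z) - U.symm z) := by simp
    rw [h2, U.norm_map]
    exact h1.trans_lt hCδ
  · refine U.toContinuousLinearEquiv.differentiable.comp ?_
    rw [differentiable_euclidean]
    intro i
    fin_cases i <;> (simp [fingerDisc]; try fun_prop)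
  · intro ζ hζ
    rw [← hU, ← map_sub, U.norm_map]
    exact (norm_fingerDisc_sub_le (by linarith) hζ).trans_lt h2δ
  · intro ζ hζ
    refine ⟨?_, ?_, ?_⟩
    · simpa using hr ζ hζ
    · simp [fingerMap_fingerCircle hN hζ]
    · simp [fingerCircle]

/-! ### The inductive construction -/

/-- A stage of the construction: a biholomorphic embedding of a neighbourhood of the closed ball,
together with a tolerance for the total size of all later changes. -/
structure Stage where
  map : EuclideanSpace ℂ (Fin 3) → EuclideanSpace ℂ (Fin 3)
  domain : Set (EuclideanSpace ℂ (Fin 3))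
  tol : ℝ
  isBiholEmbedding : IsBiholEmbedding map domain
  closedBall_subset : Metric.closedBall 0 1 ⊆ domain
  tol_pos : 0 < tol

/-- There is an obstruction to Runge approximation near `p` of `f '' V` by larger domains: a
holomorphic function `h` on `f '' V`, equal to a multiple of `ζ⁻¹` on the boundary of a holomorphic
disc `D` that lies in the `δ`-ball about `p`. The boundary of `D` lies in the image of the ball of
radius `r`. -/
def HasDiscObstruction (f : EuclideanSpace ℂ (Fin 3) → EuclideanSpace ℂ (Fin 3))
    (V : Set (EuclideanSpace ℂ (Fin 3))) (r : ℝ) (p : EuclideanSpace ℂ (Fin 3)) (δ : ℝ) : Prop :=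
  ∃ (h : EuclideanSpace ℂ (Fin 3) → ℂ) (D : ℂ → EuclideanSpace ℂ (Fin 3)) (ρ : ℝ), 0 < ρ ∧
    DifferentiableOn ℂ h (f '' V) ∧
    (∀ ζ, ‖ζ‖ ≤ 1 → DifferentiableAt ℂ D ζ ∧ ‖D ζ - p‖ < δ) ∧
    ∀ ζ, ‖ζ‖ = 1 → D ζ ∈ f '' Metric.closedBall 0 r ∧ h (D ζ) = ρ * ζ⁻¹

/-- The next stage `T` changes `S` by at most half its tolerance and has a disc obstruction near the
image of `q`. Changes of `T` within its own tolerance move the preimages of points by less than `η`,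
and do not affect the boundary of the obstructing disc. -/
def IsNextStage (q : EuclideanSpace ℂ (Fin 3)) (η : ℝ) (S T : Stage) : Prop :=
  T.tol ≤ S.tol / 2 ∧ (∀ z ∈ Metric.closedBall 0 1, ‖T.map z - S.map z‖ ≤ S.tol / 2) ∧
    ∃ r, 1 / 2 ≤ r ∧ r < 1 ∧ HasDiscObstruction T.map T.domain r (S.map q) S.tol ∧
      ∀ x ∈ Metric.closedBall 0 1, ∀ y, ‖y - T.map x‖ ≤ T.tol →
        ∃ x' ∈ T.domain, T.map x' = y ∧ ‖x' - x‖ < min η (1 - r)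

lemma exists_isNextStage (S : Stage) {q : EuclideanSpace ℂ (Fin 3)} (hq : ‖q‖ = 1) {η : ℝ}
    (hη : 0 < η) : ∃ T, IsNextStage q η S T := by
  have hK : IsCompact (Metric.closedBall (0 : EuclideanSpace ℂ (Fin 3)) 1) :=
    isCompact_closedBall 0 1
  obtain ⟨δ, hδ, hmod⟩ := S.isBiholEmbedding.exists_modulus hK S.closedBall_subset
    (half_pos S.tol_pos)
  obtain ⟨ψ, W, l, κ, d, ρ, r, hψ, hW, hψid, hρ, hr, hd, hdq, hκ⟩ := exists_finger hq hδ
  have hcomp := S.isBiholEmbedding.comp hψ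
  have hsub : Metric.closedBall 0 1 ⊆ W ∩ ψ ⁻¹' S.domain := fun z hz =>
    ⟨hW hz, (hmod z hz _ (hψid z hz)).1⟩
  -- enlarging `r` to at least `1 / 2` makes `1 - r ≤ r`, so that `0` cannot leave the `r`-ball
  obtain ⟨τ, hτ, hτx⟩ := hcomp.exists_tolerance hK hsub
    (show 0 < min η (1 - max r (1 / 2)) from
      lt_min hη (sub_pos.2 (max_lt hr (by norm_num))))
  obtain ⟨g, hg, hgf⟩ := hcomp.exists_inverse
  have hqb : q ∈ Metric.closedBall (0 : EuclideanSpace ℂ (Fin 3)) 1 := by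
    rw [mem_closedBall_zero_iff, hq]
  refine ⟨⟨S.map ∘ ψ, W ∩ ψ ⁻¹' S.domain, min τ (S.tol / 2), hcomp, hsub,
    lt_min hτ (half_pos S.tol_pos)⟩, min_le_right _ _, fun z hz => ?_, max r (1 / 2),
    le_max_right _ _, max_lt hr (by norm_num),
    ⟨fun y => l (g y), S.map ∘ d, ρ, hρ, ?_, fun ζ hζ => ⟨?_, ?_⟩, fun ζ hζ => ⟨?_, ?_⟩⟩,
    fun x hx y hy => hτx x hx y (hy.trans (min_le_left _ _))⟩
  · exact (hmod z hz _ (hψid z hz)).2.le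
  · exact l.differentiable.comp_differentiableOn hg
  · have hm := (hmod q hqb _ (hdq ζ hζ)).1
    exact (S.isBiholEmbedding.differentiableOn.differentiableAt
      (S.isBiholEmbedding.isOpen.mem_nhds hm)).comp ζ (hd ζ)
  · have := (hmod q hqb _ (hdq ζ hζ)).2
    simp only [Function.comp_apply]
    linarith [S.tol_pos]
  · exact ⟨κ ζ, Metric.closedBall_subset_closedBall (le_max_left _ _) (hκ ζ hζ).1,
      congrArg S.map (hκ ζ hζ).2.1⟩
  · have h1 : κ ζ ∈ W ∩ ψ ⁻¹' S.domain :=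
      hsub (Metric.closedBall_subset_closedBall hr.le (hκ ζ hζ).1)
    have h2 : S.map (d ζ) = (S.map ∘ ψ) (κ ζ) := congrArg S.map (hκ ζ hζ).2.1.symm
    show l (g (S.map (d ζ))) = _
    rw [h2, hgf _ h1, (hκ ζ hζ).2.2]

/-- A sequence on the unit sphere every tail of which is dense. -/
lemma exists_dense_recurrent :
    ∃ q : ℕ → EuclideanSpace ℂ (Fin 3), (∀ n, ‖q n‖ = 1) ∧
      ∀ p, ‖p‖ = 1 → ∀ δ > 0, ∀ M, ∃ n ≥ M, ‖q n - p‖ < δ := by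
  have : Nonempty (Metric.sphere (0 : EuclideanSpace ℂ (Fin 3)) 1) :=
    ⟨⟨EuclideanSpace.single 0 1, by simp⟩⟩
  set u := TopologicalSpace.denseSeq (Metric.sphere (0 : EuclideanSpace ℂ (Fin 3)) 1)
  refine ⟨fun n => u n.unpair.1, fun n => mem_sphere_zero_iff_norm.1 (u _).2,
    fun p hp δ hδ M => ?_⟩
  obtain ⟨i, hi⟩ := (TopologicalSpace.denseRange_denseSeq _).exists_dist_lt
    (⟨p, mem_sphere_zero_iff_norm.2 hp⟩ : Metric.sphere (0 : EuclideanSpace ℂ (Fin 3)) 1) hδ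
  refine ⟨Nat.pair i M, Nat.right_le_pair i M, ?_⟩
  simp only [Nat.unpair_pair]
  rw [← dist_eq_norm, dist_comm]
  exact hi

/-- A disc obstruction inside `Ω` contradicts the Runge property: the approximants are holomorphic
on the disc, so their circle integrals vanish, while that of `ρ ζ⁻¹` does not. -/
lemma not_isRungePair_of_hasDiscObstruction
    {f : EuclideanSpace ℂ (Fin 3) → EuclideanSpace ℂ (Fin 3)}
    {V U Ω : Set (EuclideanSpace ℂ (Fin 3))} {r δ : ℝ} {p : EuclideanSpace ℂ (Fin 3)}
    (h : HasDiscObstruction f V r p δ) (hU : U ⊆ f '' V) (hr : f '' Metric.closedBall 0 r ⊆ U)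
    (hp : Metric.ball p δ ⊆ Ω) : ¬ IsRungePair U Ω := by
  intro hR
  obtain ⟨h, D, ρ, hρ, hh, hD, hcirc⟩ := h
  have hDΩ : ∀ ζ, ‖ζ‖ ≤ 1 → D ζ ∈ Ω := fun ζ hζ => hp (by
    rw [Metric.mem_ball, dist_eq_norm]; exact (hD ζ hζ).2)
  have hDc : ContinuousOn D (Metric.sphere 0 1) := fun ζ hζ =>
    (hD ζ (mem_sphere_zero_iff_norm.1 hζ).le).1.continuousAt.continuousWithinAt
  obtain ⟨g, hg, hgh⟩ := hR.approx h (hh.mono hU) (D '' Metric.sphere 0 1)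
    ((isCompact_sphere 0 1).image_of_continuousOn hDc) (by
      rintro _ ⟨ζ, hζ, rfl⟩
      exact hr (hcirc ζ (mem_sphere_zero_iff_norm.1 hζ)).1) ρ hρ
  have hgD : DifferentiableOn ℂ (fun ζ => g (D ζ)) (Metric.closedBall 0 1) := fun ζ hζ => by
    rw [mem_closedBall_zero_iff] at hζ
    exact ((hg.differentiableAt (hR.isOpen_right.mem_nhds (hDΩ ζ hζ))).comp ζ
      (hD ζ hζ).1).differentiableWithinAt
  have hint : (∮ ζ in C(0, 1), g (D ζ)) = 0 := by
    refine DiffContOnCl.circleIntegral_eq_zero zero_le_one (DifferentiableOn.diffContOnCl ?_)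
    rwa [closure_ball _ one_ne_zero]
  have hinv : (∮ ζ in C(0, 1), (ρ : ℂ) * ζ⁻¹) = ρ * (2 * Real.pi * Complex.I) := by
    rw [circleIntegral.integral_const_mul]
    have := circleIntegral.integral_sub_center_inv (0 : ℂ) (one_ne_zero (α := ℝ))
    simp only [sub_zero] at this
    rw [this]
  have hdiff : ∀ ζ ∈ Metric.sphere (0 : ℂ) 1, ‖g (D ζ) - ρ * ζ⁻¹‖ < ρ := fun ζ hζ => by
    rw [← (hcirc ζ (mem_sphere_zero_iff_norm.1 hζ)).2]
    exact hgh _ ⟨ζ, hζ, rfl⟩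
  have hc1 : ContinuousOn (fun ζ => g (D ζ)) (Metric.sphere 0 1) :=
    hgD.continuousOn.mono Metric.sphere_subset_closedBall
  have hc2 : ContinuousOn (fun ζ : ℂ => (ρ : ℂ) * ζ⁻¹) (Metric.sphere 0 1) := by
    refine continuousOn_const.mul (continuousOn_inv₀.mono fun ζ hζ => ?_)
    rintro rfl
    simp at hζ
  have hlt := circleIntegral.norm_integral_lt_of_norm_le_const_of_lt (c := 0) one_pos
    (hc1.sub hc2) (fun ζ hζ => (hdiff ζ hζ).le) ⟨1, by simp, hdiff 1 (by simp)⟩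
  rw [show (∮ ζ in C(0, 1), ((fun ζ => g (D ζ)) - fun ζ : ℂ => (ρ : ℂ) * ζ⁻¹) ζ) =
    (∮ ζ in C(0, 1), g (D ζ)) - ∮ ζ in C(0, 1), (ρ : ℂ) * ζ⁻¹ from
    circleIntegral.integral_sub (hc1.circleIntegrable zero_le_one)
      (hc2.circleIntegrable zero_le_one), hint, hinv, zero_sub, norm_neg] at hlt
  simp [abs_of_pos hρ, abs_of_pos Real.pi_pos] at hlt
  linarith

theorem theorem1 (ε : ℝ) (hε : 0 < ε) :
    ∃ φ : EuclideanSpace ℂ (Fin 3) → EuclideanSpace ℂ (Fin 3),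
      ContinuousOn φ (Metric.closedBall 0 1) ∧
      Set.InjOn φ (Metric.closedBall 0 1) ∧
      DifferentiableOn ℂ φ (Metric.ball 0 1) ∧
      (∀ z ∈ Metric.closedBall (0 : EuclideanSpace ℂ (Fin 3)) 1, ‖φ z - z‖ < ε) ∧
      ∀ Ω : Set (EuclideanSpace ℂ (Fin 3)), IsOpen Ω → IsConnected Ω →
        IsRungePair (φ '' Metric.ball 0 1) Ω → φ '' Metric.ball 0 1 = Ω := by
  obtain ⟨q, hq, hdense⟩ := exists_dense_recurrent
  have hnext : ∀ (n : ℕ) (S : Stage), ∃ T, IsNextStage (q n) (1 / ((n : ℝ) + 1)) S T := fun n S =>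
    exists_isNextStage S (hq n) Nat.one_div_pos_of_nat
  choose next hnext using hnext
  let S : ℕ → Stage := fun n => Nat.rec
    ⟨id, Set.univ, ε / 2, IsBiholEmbedding.id, Set.subset_univ _, half_pos hε⟩ next n
  have hS : ∀ n, IsNextStage (q n) (1 / ((n : ℝ) + 1)) (S n) (S (n + 1)) := fun n => hnext n (S n)
  have htol : ∀ j k, (S (j + k)).tol ≤ (S j).tol / 2 ^ k := by
    intro j k
    induction k with
    | zero => simp
    | succ k ih =>
      calc (S (j + (k + 1))).tol ≤ (S (j + k)).tol / 2 := (hS (j + k)).1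
        _ ≤ (S j).tol / 2 ^ k / 2 := by gcongr
        _ = _ := by rw [pow_succ, div_div]
  have htol0 : Filter.Tendsto (fun n => (S n).tol) Filter.atTop (nhds 0) := by
    refine squeeze_zero (g := fun n => (S 0).tol / 2 ^ n) (fun n => (S n).tol_pos.le) (fun n => ?_)
      (tendsto_const_nhds.div_atTop (tendsto_pow_atTop_atTop_of_one_lt one_lt_two))
    simpa using htol 0 n
  have hstep : ∀ j, ∀ z ∈ Metric.closedBall (0 : EuclideanSpace ℂ (Fin 3)) 1, ∀ k,
      dist ((S (j + k)).map z) ((S (j + (k + 1))).map z) ≤ (S j).tol / 2 / 2 ^ k := by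
    intro j z hz k
    rw [dist_comm, dist_eq_norm]
    refine ((hS (j + k)).2.1 z hz).trans ?_
    rw [div_right_comm]
    gcongr
    exact htol j k
  have hlim : ∀ z ∈ Metric.closedBall (0 : EuclideanSpace ℂ (Fin 3)) 1,
      ∃ y, Filter.Tendsto (fun n => (S n).map z) Filter.atTop (nhds y) := fun z hz =>
    cauchySeq_tendsto_of_complete
      (cauchySeq_of_le_geometric_two fun k => by simpa using hstep 0 z hz k)
  choose! φ hφ using hlim
  have hclose : ∀ j, ∀ z ∈ Metric.closedBall (0 : EuclideanSpace ℂ (Fin 3)) 1,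
      ‖φ z - (S j).map z‖ ≤ (S j).tol := by
    intro j z hz
    have h := dist_le_of_le_geometric_two_of_tendsto₀ (hstep j z hz) (a := φ z) (by
      simpa only [add_comm j] using (Filter.tendsto_add_atTop_iff_nat j).2 (hφ z hz))
    rwa [dist_comm, dist_eq_norm] at h
  have hcontS : ∀ n, ContinuousOn (S n).map (Metric.closedBall 0 1) := fun n =>
    (S n).isBiholEmbedding.continuousOn.mono (S n).closedBall_subset
  have hcont : ContinuousOn φ (Metric.closedBall 0 1) := by
    have hunif : TendstoUniformlyOn (fun n => (S n).map) φ Filter.atTop (Metric.closedBall 0 1) := by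
      rw [Metric.tendstoUniformlyOn_iff]
      intro e he
      filter_upwards [htol0.eventually (gt_mem_nhds he)] with n hn z hz
      rw [dist_eq_norm]
      exact (hclose n z hz).trans_lt hn
    exact hunif.continuousOn (Filter.Frequently.of_forall hcontS)
  -- points with the same image under `φ` are close to one point, their common preimage at stage `n`
  have hinj : Set.InjOn φ (Metric.closedBall 0 1) := by
    intro x hx y hy hxy
    by_contra hne
    have hpos : 0 < ‖x - y‖ / 2 := half_pos (norm_pos_iff.2 (sub_ne_zero.2 hne))
    obtain ⟨n, hn⟩ := exists_nat_one_div_lt hpos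
    obtain ⟨-, -, r, -, -, -, hpre⟩ := hS n
    obtain ⟨x', hx', hxφ, hxx⟩ := hpre x hx (φ x) (hclose (n + 1) x hx)
    obtain ⟨y', hy', hyφ, hyy⟩ := hpre y hy (φ y) (hclose (n + 1) y hy)
    have : x' = y' := (S (n + 1)).isBiholEmbedding.injOn hx' hy' (by rw [hxφ, hyφ, hxy])
    have h1 : ‖x - y‖ ≤ ‖x' - x‖ + ‖y' - y‖ := by
      calc ‖x - y‖ = ‖(y' - y) - (x' - x)‖ := by rw [this]; congr 1; abel
        _ ≤ ‖y' - y‖ + ‖x' - x‖ := norm_sub_le _ _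
        _ = _ := add_comm _ _
    have h2 := hxx.trans_le (min_le_left _ _)
    have h3 := hyy.trans_le (min_le_left _ _)
    linarith
  refine ⟨φ, hcont, hinj, ?_, ?_, ?_⟩
  · exact differentiableOn_ball_of_uniform_limit htol0
      (fun n => (S n).isBiholEmbedding.differentiableOn.mono
        (Metric.ball_subset_closedBall.trans (S n).closedBall_subset))
      (fun n z hz => hclose n z (Metric.ball_subset_closedBall hz))
  · intro z hz
    have h : ‖φ z - z‖ ≤ ε / 2 := hclose 0 z hz
    linarith
  intro Ω hΩ hΩc hR
  have hcb : closure (φ '' Metric.ball 0 1) ⊆ φ '' Metric.closedBall 0 1 :=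
    closure_minimal (Set.image_mono Metric.ball_subset_closedBall)
      ((isCompact_closedBall 0 1).image_of_continuousOn hcont).isClosed
  have h0 : (0 : EuclideanSpace ℂ (Fin 3)) ∈ Metric.ball (0 : EuclideanSpace ℂ (Fin 3)) 1 :=
    Metric.mem_ball_self one_pos
  refine Set.Subset.antisymm hR.subset
    (hΩc.isPreconnected.subset_of_closure_inter_subset hR.isOpen_left
      ⟨φ 0, hR.subset ⟨0, h0, rfl⟩, ⟨0, h0, rfl⟩⟩ ?_)
  -- otherwise `Ω` contains a boundary point `φ p`, and with it an obstructing disc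
  rintro _ ⟨hy, hyΩ⟩
  obtain ⟨p, hp, rfl⟩ := hcb hy
  by_contra hpU
  have hp1 : ‖p‖ = 1 := by
    refine le_antisymm (mem_closedBall_zero_iff.1 hp) (not_lt.1 fun h => hpU ⟨p, ?_, rfl⟩)
    rwa [mem_ball_zero_iff]
  obtain ⟨e, he, heΩ⟩ := Metric.isOpen_iff.1 hΩ _ hyΩ
  obtain ⟨δ, hδ, hδφ⟩ := Metric.continuousOn_iff.1 hcont p hp (e / 3) (by positivity)
  obtain ⟨M, hM⟩ := Filter.eventually_atTop.1
    (htol0.eventually (gt_mem_nhds (show 0 < e / 3 by positivity)))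
  obtain ⟨n, hnM, hn⟩ := hdense p hp1 δ hδ M
  have hqn : q n ∈ Metric.closedBall (0 : EuclideanSpace ℂ (Fin 3)) 1 := by
    rw [mem_closedBall_zero_iff, hq n]
  obtain ⟨-, -, r, hr2, hr1, hobs, hpre⟩ := hS n
  refine not_isRungePair_of_hasDiscObstruction hobs ?_ ?_ (Set.Subset.trans ?_ heΩ) hR
  · rintro _ ⟨z, hz, rfl⟩
    have hz' := Metric.ball_subset_closedBall hz
    obtain ⟨z', hz', h, -⟩ := hpre z hz' (φ z) (hclose (n + 1) z hz')
    exact ⟨z', hz', h⟩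
  · -- `φ '' sphere` misses the image of the ball of radius `r`, so the open set `φ '' ball` is
    -- relatively closed in this connected image
    have hrsub : Metric.closedBall (0 : EuclideanSpace ℂ (Fin 3)) r ⊆ Metric.closedBall 0 1 :=
      Metric.closedBall_subset_closedBall hr1.le
    have hconn : IsPreconnected ((S (n + 1)).map '' Metric.closedBall 0 r) :=
      (convex_closedBall 0 r).isPreconnected.image _ ((hcontS (n + 1)).mono hrsub)
    refine hconn.subset_of_closure_inter_subset hR.isOpen_left ?_ ?_
    · have h0c := Metric.ball_subset_closedBall h0
      obtain ⟨z', -, h, hz'⟩ := hpre 0 h0c (φ 0) (hclose (n + 1) 0 h0c)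
      refine ⟨φ 0, ⟨z', ?_, h⟩, 0, h0, rfl⟩
      rw [sub_zero] at hz'
      rw [mem_closedBall_zero_iff]
      linarith [hz'.trans_le (min_le_right _ _)]
    · rintro _ ⟨hy, ⟨z, hz, rfl⟩⟩
      obtain ⟨x, hx, hxz⟩ := hcb hy
      obtain ⟨x', hx', h, hxx⟩ := hpre x hx (φ x) (hclose (n + 1) x hx)
      have hzx : x' = z := (S (n + 1)).isBiholEmbedding.injOn hx'
        ((S (n + 1)).closedBall_subset (hrsub hz)) (h.trans hxz)
      refine ⟨x, ?_, hxz⟩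
      rw [mem_closedBall_zero_iff] at hz
      rw [mem_ball_zero_iff]
      have h1 := hxx.trans_le (min_le_right _ _)
      have h2 : ‖x‖ ≤ ‖z‖ + ‖x' - x‖ := by
        calc ‖x‖ = ‖z - (x' - x)‖ := by rw [hzx]; congr 1; abel
          _ ≤ _ := norm_sub_le _ _
      linarith
  · -- the disc is close to `(S n).map (q n)`, hence to `φ (q n)`, hence to `φ p`
    intro y hy
    rw [Metric.mem_ball] at hy ⊢
    have h1 : dist ((S n).map (q n)) (φ (q n)) < e / 3 := by
      rw [dist_comm, dist_eq_norm]
      exact (hclose n _ hqn).trans_lt (hM n hnM)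
    have h2 := hδφ (q n) hqn (by rw [dist_eq_norm]; exact hn)
    have h3 := hM n hnM
    linarith [dist_triangle y ((S n).map (q n)) (φ p),
      dist_triangle ((S n).map (q n)) (φ (q n)) (φ p)]
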